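/- Let $\mathbf{C}^*$ be the category of unital (complex) $C^*$-algebras with unital $*$-homomorphisms as morphisms. Let $\mathbf{OSys}$ be the category whose objects are the (abstract, not necessarily complete) operator systems, i.e. complex $*$-vector spaces $S$ equipped with cones $C_n\subseteq M_n(S)_h$ ($n\in\mathbb N$) with $C_n\cap(-C_n)=\{0\}$ and $\alpha^* C_n\alpha\subseteq C_m$ for all $\alpha\in M_{n,m}(\mathbb C)$, together with an Archimedean matrix order unit $e\in S$; its morphisms are the unital completely positive linear maps. Let $U:\mathbf{C}^*\to\mathbf{OSys}$ be the forgetful functor that sends a unital $C^*$-algebra $A$ to its underlying $*$-vector space, with $e=1_A$ and $C_n$ the cone of positive elements of the $C^*$-algebra $M_n(A)$, and a unital $*$-homomorphism to itself as a unital completely positive map. Then $U$ is monadic: $U$ has a left adjoint $F$, and the comparison functor from $\mathbf{C}^*$ to the Eilenberg-Moore category $\mathbf{OSys}^{UF}$ of algebras over the monad $UF$ is an equivalence of categories. -/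

import Mathlib

universe u

open CategoryTheory

/-- The congruence `αᴴ M α` of a matrix `M` with entries in a complex vector space `V` by a
rectangular scalar matrix `α`. -/
def matrixCongr {V : Type*} [AddCommGroup V] [Module ℂ V] {n m : ℕ}
    (α : Matrix (Fin n) (Fin m) ℂ) (M : Matrix (Fin n) (Fin n) V) : Matrix (Fin m) (Fin m) V :=
  Matrix.of fun i j => ∑ k, ∑ l, (star (α k i) * α l j) • M k l

/-- The matrix `eₙ = diag(e, …, e)`. -/
def diagUnit {V : Type*} [AddCommGroup V] (e : V) (n : ℕ) : Matrix (Fin n) (Fin n) V :=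
  Matrix.diagonal fun _ => e

/-- An (abstract, not necessarily complete) operator system structure on a complex `*`-vector
space `V`: a matrix ordering (a family of proper cones `posCone n` of hermitian matrices in
`Mₙ(V)`, compatible with scalar congruences) together with an Archimedean matrix order unit
`e`. -/
class OperatorSystem (V : Type*) [AddCommGroup V] [Module ℂ V] [StarAddMonoid V]
    [StarModule ℂ V] where
  /-- the matrix order unit -/
  e : V
  /-- the positive cone of `Mₙ(V)` -/
  posCone : ∀ n : ℕ, Set (Matrix (Fin n) (Fin n) V)
  isHermitian_of_mem : ∀ (n : ℕ) (M : Matrix (Fin n) (Fin n) V), M ∈ posCone n → M.IsHermitian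
  zero_mem : ∀ n : ℕ, (0 : Matrix (Fin n) (Fin n) V) ∈ posCone n
  add_mem : ∀ (n : ℕ) (M N : Matrix (Fin n) (Fin n) V),
    M ∈ posCone n → N ∈ posCone n → M + N ∈ posCone n
  smul_mem : ∀ (n : ℕ) (r : ℝ) (M : Matrix (Fin n) (Fin n) V),
    0 ≤ r → M ∈ posCone n → (r : ℂ) • M ∈ posCone n
  proper : ∀ (n : ℕ) (M : Matrix (Fin n) (Fin n) V), M ∈ posCone n → -M ∈ posCone n → M = 0
  congr_mem : ∀ (n m : ℕ) (α : Matrix (Fin n) (Fin m) ℂ) (M : Matrix (Fin n) (Fin n) V),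
    M ∈ posCone n → matrixCongr α M ∈ posCone m
  e_isSelfAdjoint : IsSelfAdjoint e
  order_unit : ∀ (n : ℕ) (M : Matrix (Fin n) (Fin n) V), M.IsHermitian →
    ∃ r : ℝ, 0 < r ∧ (r : ℂ) • diagUnit e n - M ∈ posCone n
  archimedean : ∀ (n : ℕ) (M : Matrix (Fin n) (Fin n) V), M.IsHermitian →
    (∀ r : ℝ, 0 < r → (r : ℂ) • diagUnit e n + M ∈ posCone n) → M ∈ posCone n

/-- Unital completely positive (ucp) maps between operator systems. -/
@[ext]
structure UCPMap (V W : Type*) [AddCommGroup V] [Module ℂ V] [StarAddMonoid V] [StarModule ℂ V]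
    [OperatorSystem V] [AddCommGroup W] [Module ℂ W] [StarAddMonoid W] [StarModule ℂ W]
    [OperatorSystem W] extends V →ₗ[ℂ] W where
  map_e : toFun OperatorSystem.e = OperatorSystem.e
  map_posCone : ∀ (n : ℕ) (M : Matrix (Fin n) (Fin n) V),
    M ∈ OperatorSystem.posCone n → M.map toFun ∈ OperatorSystem.posCone (V := W) n

/-- A (bundled) operator system. -/
structure OSys : Type (u + 1) where
  carrier : Type u
  [addCommGroup : AddCommGroup carrier]
  [module : Module ℂ carrier]
  [starAddMonoid : StarAddMonoid carrier]
  [starModule : StarModule ℂ carrier]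
  [operatorSystem : OperatorSystem carrier]

attribute [instance] OSys.addCommGroup OSys.module OSys.starAddMonoid OSys.starModule
  OSys.operatorSystem

/-- The category of operator systems and ucp maps. -/
instance OSys.category : Category.{u, u + 1} OSys.{u} where
  Hom V W := UCPMap V.carrier W.carrier
  id V :=
    { toLinearMap := LinearMap.id
      map_e := rfl
      map_posCone := fun _ _ h => h }
  comp f g :=
    { toLinearMap := g.toLinearMap.comp f.toLinearMap
      map_e := (congrArg g.toFun f.map_e).trans g.map_e
      map_posCone := fun n M h => g.map_posCone n _ (f.map_posCone n M h) }

/-- A (bundled) unital (complex) C*-algebra. -/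
structure UnitalCStarAlg : Type (u + 1) where
  carrier : Type u
  [cStarAlgebra : CStarAlgebra carrier]

attribute [instance] UnitalCStarAlg.cStarAlgebra

/-- The category of unital C*-algebras and unital `*`-homomorphisms. -/
instance UnitalCStarAlg.category : Category.{u, u + 1} UnitalCStarAlg.{u} where
  Hom A B := A.carrier →⋆ₐ[ℂ] B.carrier
  id A := StarAlgHom.id ℂ A.carrier
  comp f g := g.comp f

section CStar

attribute [local instance] CStarAlgebra.spectralOrder CStarAlgebra.spectralOrderedRing

theorem CStarAlgebra.nonneg_iff_star_mul_self' {B : Type*} [CStarAlgebra B] [PartialOrder B]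
    [StarOrderedRing B] (b : B) : 0 ≤ b ↔ ∃ c : B, b = star c * c :=
  CStarAlgebra.nonneg_iff_eq_star_mul_self

theorem CStarAlgebra.exists_smul_one_sub_nonneg {B : Type*} [CStarAlgebra B] [PartialOrder B]
    [StarOrderedRing B] (b : B) (hb : IsSelfAdjoint b) :
    ∃ r : ℝ, 0 < r ∧ 0 ≤ (r : ℂ) • (1 : B) - b := by
  refine ⟨‖b‖ + 1, by positivity, sub_nonneg.2 ?_⟩
  have h1 := hb.le_algebraMap_norm_self
  have h2 : (0 : B) ≤ 1 := zero_le_one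
  rw [Algebra.algebraMap_eq_smul_one] at h1
  rw [Complex.coe_smul, add_smul, one_smul]
  exact h1.trans (le_add_of_nonneg_right h2)

theorem CStarAlgebra.nonneg_of_forall_smul_one_add_nonneg {B : Type*} [CStarAlgebra B]
    [PartialOrder B] [StarOrderedRing B] (b : B)
    (hb : ∀ r : ℝ, 0 < r → 0 ≤ (r : ℂ) • (1 : B) + b) : 0 ≤ b := by
  have hc : Filter.Tendsto (fun r : ℝ => (r : ℂ) • (1 : B) + b) (nhdsWithin 0 (Set.Ioi 0))
      (nhds b) := by
    have : Continuous fun r : ℝ => (r : ℂ) • (1 : B) + b := by fun_prop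
    have h := this.tendsto 0
    simp only [Complex.ofReal_zero, zero_smul, zero_add] at h
    exact h.mono_left nhdsWithin_le_nhds
  refine CStarAlgebra.isClosed_nonneg.mem_of_tendsto hc ?_
  filter_upwards [self_mem_nhdsWithin] with r hr using hb r hr

/-- The positive cone of the C*-algebra `Mₙ(A)`. -/
def cstarPosCone (A : Type*) [CStarAlgebra A] (n : ℕ) : Set (Matrix (Fin n) (Fin n) A) :=
  {M | 0 ≤ CStarMatrix.ofMatrix M}

theorem mem_cstarPosCone_iff {A : Type*} [CStarAlgebra A] {n : ℕ}
    (M : Matrix (Fin n) (Fin n) A) :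
    M ∈ cstarPosCone A n ↔ ∃ N : Matrix (Fin n) (Fin n) A, M = N.conjTranspose * N :=
  CStarAlgebra.nonneg_iff_star_mul_self' (B := CStarMatrix (Fin n) (Fin n) A)
    (CStarMatrix.ofMatrix M)

theorem cstarPosCone_add {A : Type*} [CStarAlgebra A] {n : ℕ} {M N : Matrix (Fin n) (Fin n) A}
    (hM : M ∈ cstarPosCone A n) (hN : N ∈ cstarPosCone A n) : M + N ∈ cstarPosCone A n :=
  add_nonneg (α := CStarMatrix (Fin n) (Fin n) A) hM hN

theorem cstarPosCone_zero (A : Type*) [CStarAlgebra A] (n : ℕ) :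
    (0 : Matrix (Fin n) (Fin n) A) ∈ cstarPosCone A n :=
  le_refl (0 : CStarMatrix (Fin n) (Fin n) A)

/-- Gram matrices of rectangular matrices are positive. -/
theorem conjTranspose_mul_self_mem_cstarPosCone {A : Type*} [CStarAlgebra A] {n m : ℕ}
    (P : Matrix (Fin n) (Fin m) A) : P.conjTranspose * P ∈ cstarPosCone A m := by
  rcases m with _ | m
  · convert cstarPosCone_zero A 0
    exact Subsingleton.elim _ _
  · have key : P.conjTranspose * P = ∑ k : Fin n,
        (Matrix.of fun (i j : Fin (m + 1)) => if i = 0 then P k j else 0).conjTranspose *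
          (Matrix.of fun (i j : Fin (m + 1)) => if i = 0 then P k j else 0) := by
      ext i j
      rw [Matrix.sum_apply]
      simp [Matrix.mul_apply, apply_ite]
    rw [key]
    refine Finset.sum_induction _ (· ∈ cstarPosCone A (m + 1)) (fun _ _ => cstarPosCone_add)
      (cstarPosCone_zero A _) (fun k _ => ?_)
    exact (mem_cstarPosCone_iff _).2 ⟨_, rfl⟩

theorem cstarPosCone_congr {A : Type*} [CStarAlgebra A] {n m : ℕ}
    (α : Matrix (Fin n) (Fin m) ℂ) {M : Matrix (Fin n) (Fin n) A} (hM : M ∈ cstarPosCone A n) :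
    matrixCongr α M ∈ cstarPosCone A m := by
  obtain ⟨N, rfl⟩ := (mem_cstarPosCone_iff M).1 hM
  have key : matrixCongr α (N.conjTranspose * N) =
      (N * α.map (algebraMap ℂ A)).conjTranspose * (N * α.map (algebraMap ℂ A)) := by
    ext i j
    simp only [matrixCongr, Matrix.of_apply, Matrix.mul_apply, Matrix.conjTranspose_apply,
      Matrix.map_apply, star_sum, Algebra.algebraMap_eq_smul_one, star_smul,
      mul_smul_comm, smul_mul_assoc, mul_one, Finset.smul_sum, Finset.sum_mul,
      Finset.mul_sum, smul_smul]
    rw [Finset.sum_comm, Finset.sum_congr rfl fun y _ => Finset.sum_comm, Finset.sum_comm]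
    simp only [mul_comm]
  rw [key]
  exact conjTranspose_mul_self_mem_cstarPosCone _

/-- The canonical operator system structure of a unital C*-algebra: the order unit is `1` and
the positive cones are those of the C*-algebras `Mₙ(A)`. -/
instance CStarAlgebra.operatorSystem (A : Type*) [CStarAlgebra A] : OperatorSystem A where
  e := 1
  posCone := cstarPosCone A
  isHermitian_of_mem n M hM :=
    IsSelfAdjoint.of_nonneg (R := CStarMatrix (Fin n) (Fin n) A) hM
  zero_mem := cstarPosCone_zero A
  add_mem _ _ _ := cstarPosCone_add
  smul_mem n r M hr hM := by
    obtain ⟨N, rfl⟩ := (mem_cstarPosCone_iff M).1 hM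
    refine (mem_cstarPosCone_iff _).2 ⟨(Real.sqrt r : ℂ) • N, ?_⟩
    rw [Matrix.conjTranspose_smul, Matrix.smul_mul, Matrix.mul_smul, smul_smul,
      Complex.star_def, Complex.conj_ofReal, ← Complex.ofReal_mul, Real.mul_self_sqrt hr]
  proper n M hM hM' :=
    le_antisymm (α := CStarMatrix (Fin n) (Fin n) A)
      (neg_nonneg (α := CStarMatrix (Fin n) (Fin n) A).1 hM') hM
  congr_mem _ _ α _ hM := cstarPosCone_congr α hM
  e_isSelfAdjoint := IsSelfAdjoint.one A
  order_unit n M hM :=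
    CStarAlgebra.exists_smul_one_sub_nonneg (B := CStarMatrix (Fin n) (Fin n) A)
      (CStarMatrix.ofMatrix M) hM
  archimedean n M _ h :=
    CStarAlgebra.nonneg_of_forall_smul_one_add_nonneg (B := CStarMatrix (Fin n) (Fin n) A)
      (CStarMatrix.ofMatrix M) h

/-- A unital `*`-homomorphism is a ucp map. -/
def StarAlgHom.toUCPMap {A B : Type*} [CStarAlgebra A] [CStarAlgebra B] (f : A →⋆ₐ[ℂ] B) :
    UCPMap A B where
  toLinearMap := f.toAlgHom.toLinearMap
  map_e := map_one f
  map_posCone n M hM := by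
    obtain ⟨N, rfl⟩ := (mem_cstarPosCone_iff M).1 hM
    refine (mem_cstarPosCone_iff _).2 ⟨N.map f, ?_⟩
    ext i j
    simp [Matrix.mul_apply, map_star]

end CStar

/-- The forgetful functor from unital C*-algebras and unital `*`-homomorphisms to operator
systems and ucp maps. -/
noncomputable def forgetCStarToOSys : UnitalCStarAlg.{u} ⥤ OSys.{u} where
  obj A := { carrier := A.carrier }
  map f := StarAlgHom.toUCPMap f

/-! By Beck's theorem it suffices that `forgetCStarToOSys` has a left adjoint, reflects
isomorphisms, and that pairs whose image splits have coequalizers in C*-algebras which the functor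
preserves.

The coequalizer comes from the Choi–Effros product. If `f, g : A → B` are split in operator systems
by `h`, `s`, `t`, with `g t = id` and `f t = s h`, then `p = s h` is an idempotent ucp map on `B`.
Lifting `b c` to `t b * t c` along `g` and using `h f = h g` gives `p (b c) = p (p b · p c)`
(`MulProjection.ofSplit`). Hence `p (x y)` is an associative product on the fixed points of `p`, and
`p` is a `*`-homomorphism onto them. The Kadison–Schwarz inequality (`UCPMap.star_mul_self_le`)
makes `p` contractive and yields the C*-identity. The inclusion of the fixed points is ucp, so the
coequalizer is again split in operator systems, and therefore preserved.

The left adjoint sends `V` to the C*-algebra generated by the joint image of `V` in a bounded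
product of targets of ucp maps. Order unit estimates bound each family uniformly. A target generated
by the image of `V` embeds as a set in `ℕ → FreeAlgebra ℂ V`, so the indexing family can be taken to
be small. -/

open scoped ENNReal

/-! ### Ucp maps between operator systems -/

namespace UCPMap

section Basic

variable {V W X : Type*} [AddCommGroup V] [Module ℂ V] [StarAddMonoid V] [StarModule ℂ V]
  [OperatorSystem V] [AddCommGroup W] [Module ℂ W] [StarAddMonoid W] [StarModule ℂ W]
  [OperatorSystem W] [AddCommGroup X] [Module ℂ X] [StarAddMonoid X] [StarModule ℂ X]
  [OperatorSystem X]

instance : FunLike (UCPMap V W) V W where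
  coe φ := φ.toFun
  coe_injective φ ψ h := by
    cases φ; cases ψ; congr; exact DFunLike.coe_injective h

instance : LinearMapClass (UCPMap V W) ℂ V W where
  map_add φ := φ.map_add'
  map_smulₛₗ φ := φ.map_smul'

theorem ext_apply {φ ψ : UCPMap V W} (h : ∀ v, φ v = ψ v) : φ = ψ := DFunLike.ext _ _ h

theorem apply_e (φ : UCPMap V W) : φ OperatorSystem.e = OperatorSystem.e := φ.map_e

theorem map_mem_posCone (φ : UCPMap V W) {n : ℕ} {M : Matrix (Fin n) (Fin n) V}
    (hM : M ∈ OperatorSystem.posCone n) : M.map φ ∈ OperatorSystem.posCone (V := W) n :=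
  φ.map_posCone n M hM

theorem map_smul_e_sub (φ : UCPMap V W) (c : ℂ) (v : V) :
    φ (c • OperatorSystem.e - v) = c • OperatorSystem.e - φ v := by
  rw [map_sub, map_smul, φ.apply_e]

/-- Composition of ucp maps. -/
def comp (ψ : UCPMap W X) (φ : UCPMap V W) : UCPMap V X where
  toLinearMap := ψ.toLinearMap.comp φ.toLinearMap
  map_e := (congrArg ψ.toFun φ.map_e).trans ψ.map_e
  map_posCone n M h := ψ.map_posCone n _ (φ.map_posCone n M h)

@[simp] theorem comp_apply (ψ : UCPMap W X) (φ : UCPMap V W) (v : V) :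
    ψ.comp φ v = ψ (φ v) := rfl

end Basic

end UCPMap

namespace OperatorSystem

variable {V : Type*} [AddCommGroup V] [Module ℂ V] [StarAddMonoid V] [StarModule ℂ V]
  [OperatorSystem V]

/-- The order unit dominates every self-adjoint element. -/
theorem exists_smul_e_sub_mem {v : V} (hv : IsSelfAdjoint v) :
    ∃ r : ℝ, 0 < r ∧ Matrix.of (fun _ _ : Fin 1 => (r : ℂ) • e - v) ∈ posCone 1 := by
  obtain ⟨r, hr, h⟩ := order_unit 1 (Matrix.of fun _ _ => v) (by ext i j; exact hv)
  refine ⟨r, hr, ?_⟩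
  convert h using 1
  ext i j
  simp [diagUnit, Subsingleton.elim i j]

end OperatorSystem

section Star

variable {V W : Type*} [AddCommGroup V] [Module ℂ V] [StarAddMonoid V] [StarModule ℂ V]
  [OperatorSystem V] [AddCommGroup W] [Module ℂ W] [StarAddMonoid W] [StarModule ℂ W]
  [OperatorSystem W]

/-- The order unit writes `v` as `r e - (r e - v)` with `r e - v` positive, and positive elements go
to positive, hence self-adjoint, ones. -/
theorem UCPMap.isSelfAdjoint_map (φ : UCPMap V W) {v : V} (hv : IsSelfAdjoint v) :
    IsSelfAdjoint (φ v) := by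
  obtain ⟨r, -, h⟩ := OperatorSystem.exists_smul_e_sub_mem hv
  have h2 := OperatorSystem.isHermitian_of_mem _ _ (φ.map_mem_posCone h)
  have h3 : IsSelfAdjoint ((r : ℂ) • (OperatorSystem.e : W) - φ v) := by
    have := h2.apply 0 0
    rwa [Matrix.map_apply, Matrix.of_apply, φ.map_smul_e_sub] at this
  have h4 : IsSelfAdjoint ((r : ℂ) • (OperatorSystem.e : W)) :=
    IsSelfAdjoint.smul (Complex.conj_ofReal r) OperatorSystem.e_isSelfAdjoint
  simpa using h4.sub h3

theorem UCPMap.map_star (φ : UCPMap V W) (v : V) : φ (star v) = star (φ v) := by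
  have h1 := φ.isSelfAdjoint_map (realPart v).2
  have h2 := φ.isSelfAdjoint_map (imaginaryPart v).2
  have hv := realPart_add_I_smul_imaginaryPart v
  have h3 : φ v = φ (realPart v : V) + Complex.I • φ (imaginaryPart v : V) := by
    rw [← map_smul, ← map_add, hv]
  have h4 : star v = (realPart v : V) - Complex.I • (imaginaryPart v : V) := by
    conv_lhs => rw [← hv]
    simp [star_smul, sub_eq_add_neg]
  rw [h4, h3, map_sub, map_smul, star_add, star_smul, h1.star_eq, h2.star_eq]
  simp [sub_eq_add_neg]

end Star

/-! ### Positivity and norm estimates in C*-algebras -/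

section CStar

attribute [local instance] CStarAlgebra.spectralOrder CStarAlgebra.spectralOrderedRing

variable {A B : Type*} [CStarAlgebra A] [CStarAlgebra B]

theorem of_mem_cstarPosCone_one_iff {a : A} :
    Matrix.of (fun _ _ : Fin 1 => a) ∈ cstarPosCone A 1 ↔ 0 ≤ a := by
  rw [mem_cstarPosCone_iff, CStarAlgebra.nonneg_iff_star_mul_self']
  constructor
  · rintro ⟨N, hN⟩
    refine ⟨N 0 0, ?_⟩
    simpa [Matrix.mul_apply] using congrFun (congrFun hN 0) 0
  · rintro ⟨c, rfl⟩
    refine ⟨Matrix.of fun _ _ => c, ?_⟩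
    ext i j
    simp [Matrix.mul_apply]

theorem UCPMap.map_nonneg (φ : UCPMap A B) {a : A} (ha : 0 ≤ a) : 0 ≤ φ a :=
  of_mem_cstarPosCone_one_iff.1 (φ.map_mem_posCone (of_mem_cstarPosCone_one_iff.2 ha))

theorem UCPMap.map_one (φ : UCPMap A B) : φ 1 = 1 := φ.map_e

/-- The Kadison–Schwarz inequality. -/
theorem UCPMap.star_mul_self_le (φ : UCPMap A B) (a : A) :
    star (φ a) * φ a ≤ φ (star a * a) := by
  -- The Gram matrix of the row `(1, a)` has entries `1`, `a`, `star a`, `star a * a`; its image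
  -- under `φ` is positive.
  let P : Matrix (Fin 1) (Fin 2) A := !![1, a]
  have hM : (P.conjTranspose * P).map φ ∈ cstarPosCone B 2 :=
    φ.map_mem_posCone (conjTranspose_mul_self_mem_cstarPosCone P)
  obtain ⟨N, hN⟩ := (mem_cstarPosCone_iff _).1 hM
  have h00 : 1 = star (N 0 0) * N 0 0 + star (N 1 0) * N 1 0 := by
    simpa [P, Matrix.mul_apply, φ.map_one] using congrFun (congrFun hN 0) 0
  have h01 : φ a = star (N 0 0) * N 0 1 + star (N 1 0) * N 1 1 := by
    simpa [P, Matrix.mul_apply] using congrFun (congrFun hN 0) 1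
  have h10 : star (φ a) = star (N 0 1) * N 0 0 + star (N 1 1) * N 1 0 := by
    simpa [P, Matrix.mul_apply, φ.map_star] using congrFun (congrFun hN 1) 0
  have h11 : φ (star a * a) = star (N 0 1) * N 0 1 + star (N 1 1) * N 1 1 := by
    simpa [P, Matrix.mul_apply] using congrFun (congrFun hN 1) 1
  rw [← sub_nonneg]
  -- Schur complement: if `n₀`, `n₁` are the columns of `N`, the difference is the Gram square of
  -- `n₁ - n₀ φ(a)`, because `n₀* n₀ = 1` and `n₀* n₁ = φ(a)`.
  have key : φ (star a * a) - star (φ a) * φ a =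
      star (N 0 1 - N 0 0 * φ a) * (N 0 1 - N 0 0 * φ a) +
        star (N 1 1 - N 1 0 * φ a) * (N 1 1 - N 1 0 * φ a) := by
    have e1 : star (φ a) * 1 * φ a = star (φ a) * (star (N 0 0) * N 0 0 + star (N 1 0) * N 1 0) *
      φ a := by rw [← h00]
    have e2 : star (φ a) * φ a = star (φ a) * (star (N 0 0) * N 0 1 + star (N 1 0) * N 1 1) := by
      rw [← h01]
    have e3 : star (φ a) * φ a = (star (N 0 1) * N 0 0 + star (N 1 1) * N 1 0) * φ a := by
      rw [← h10]
    rw [mul_one] at e1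
    calc _ = φ (star a * a) - star (φ a) * φ a - star (φ a) * φ a + star (φ a) * φ a := by abel
      _ = φ (star a * a) - star (φ a) * (star (N 0 0) * N 0 1 + star (N 1 0) * N 1 1)
          - (star (N 0 1) * N 0 0 + star (N 1 1) * N 1 0) * φ a
          + star (φ a) * (star (N 0 0) * N 0 0 + star (N 1 0) * N 1 0) * φ a := by
        rw [← e1, ← e2, ← e3]
      _ = _ := by
        rw [h11]
        simp only [star_sub, star_mul]
        noncomm_ring
  rw [key]
  exact add_nonneg (star_mul_self_nonneg _) (star_mul_self_nonneg _)

theorem UCPMap.norm_apply_le_of_nonneg (φ : UCPMap A B) {a : A} (ha : 0 ≤ a) :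
    ‖φ a‖ ≤ ‖a‖ := by
  rw [CStarAlgebra.norm_le_iff_le_algebraMap _ (norm_nonneg _) (φ.map_nonneg ha)]
  have h := φ.map_nonneg (sub_nonneg.2 (IsSelfAdjoint.of_nonneg ha).le_algebraMap_norm_self)
  rw [map_sub, sub_nonneg] at h
  refine h.trans_eq ?_
  rw [Algebra.algebraMap_eq_smul_one, Algebra.algebraMap_eq_smul_one, ← Complex.coe_smul,
    map_smul, φ.map_one, Complex.coe_smul]

/-- Ucp maps between C*-algebras are contractive. -/
theorem UCPMap.norm_apply_le (φ : UCPMap A B) (a : A) : ‖φ a‖ ≤ ‖a‖ := by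
  refine le_of_sq_le_sq ?_ (norm_nonneg _)
  -- The C*-identity and Kadison–Schwarz reduce the claim to the positive element `star a * a`.
  rw [sq, sq, ← CStarRing.norm_star_mul_self, ← CStarRing.norm_star_mul_self (x := a)]
  exact (CStarAlgebra.norm_le_norm_of_nonneg_of_le (star_mul_self_nonneg _)
    (φ.star_mul_self_le a)).trans (φ.norm_apply_le_of_nonneg (star_mul_self_nonneg a))

/-- Injective `*`-homomorphisms preserve the real spectrum of self-adjoint elements, and positivity
is read off from it. -/
theorem CStarAlgebra.nonneg_of_map_nonneg [PartialOrder A] [StarOrderedRing A] [PartialOrder B]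
    [StarOrderedRing B] {f : A →⋆ₐ[ℂ] B} (hf : Function.Injective f) {a : A} (ha : 0 ≤ f a) :
    0 ≤ a := by
  have hsa : IsSelfAdjoint a := by
    refine hf ?_
    rw [StarHomClass.map_star]
    exact IsSelfAdjoint.of_nonneg ha
  rw [StarOrderedRing.nonneg_iff_spectrum_nonneg (R := ℝ) a hsa]
  rw [StarOrderedRing.nonneg_iff_spectrum_nonneg (R := ℝ) (f a) (IsSelfAdjoint.of_nonneg ha),
    hsa.map_spectrum_real f hf] at ha
  exact ha

/-- An injective `*`-homomorphism is a complete order embedding. -/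
theorem mem_cstarPosCone_of_map {f : A →⋆ₐ[ℂ] B} (hf : Function.Injective f) {n : ℕ}
    {M : Matrix (Fin n) (Fin n) A} (hM : M.map f ∈ cstarPosCone B n) : M ∈ cstarPosCone A n := by
  let F : CStarMatrix (Fin n) (Fin n) A →⋆ₐ[ℂ] CStarMatrix (Fin n) (Fin n) B :=
    { toFun := fun N => N.map f
      map_one' := by
        ext i j
        by_cases h : i = j
        · subst h; simp [CStarMatrix.map_apply, _root_.map_one]
        · simp [CStarMatrix.map_apply, h]
      map_mul' := fun N N' => by
        ext i j
        simp [CStarMatrix.mul_apply, CStarMatrix.map_apply]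
      map_zero' := by ext i j; simp [CStarMatrix.map_apply]
      map_add' := fun N N' => by ext i j; simp [CStarMatrix.map_apply]
      commutes' := fun r => by
        ext i j
        by_cases h : i = j
        · subst h
          simp [CStarMatrix.map_apply, CStarMatrix.algebraMap_apply, AlgHomClass.commutes]
        · simp [CStarMatrix.map_apply, CStarMatrix.algebraMap_apply, h]
      map_star' := fun N => by
        ext i j
        simp [CStarMatrix.map_apply, CStarMatrix.star_apply, StarHomClass.map_star] }
  have hF : Function.Injective F := CStarMatrix.map_injective hf
  exact CStarAlgebra.nonneg_of_map_nonneg (A := CStarMatrix (Fin n) (Fin n) A)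
    (B := CStarMatrix (Fin n) (Fin n) B) (a := CStarMatrix.ofMatrix M) hF hM

/-- The norms of the images of a fixed element under ucp maps into C*-algebras are bounded. -/
theorem OperatorSystem.exists_norm_apply_le {V : Type*} [AddCommGroup V] [Module ℂ V]
    [StarAddMonoid V] [StarModule ℂ V] [OperatorSystem V] (v : V) :
    ∃ C : ℝ, ∀ (A : Type u) [CStarAlgebra A] (φ : UCPMap V A), ‖φ v‖ ≤ C := by
  have sa : ∀ w : V, IsSelfAdjoint w →
      ∃ C : ℝ, ∀ (A : Type u) [CStarAlgebra A] (φ : UCPMap V A), ‖φ w‖ ≤ C := by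
    intro w hw
    obtain ⟨r, hr, h⟩ := exists_smul_e_sub_mem hw
    have hsa : IsSelfAdjoint ((r : ℂ) • e - w) := by
      exact (isHermitian_of_mem _ _ h).apply 0 0
    -- Now `0 ≤ r e - w ≤ s e`, with `r` and `s` depending only on `w`; this bounds the image of `r
    -- e - w` by `s` in every target.
    obtain ⟨s, hs, h'⟩ := exists_smul_e_sub_mem hsa
    refine ⟨r + s, fun A _ φ => ?_⟩
    have key : ∀ {x : V}, Matrix.of (fun _ _ : Fin 1 => x) ∈ posCone 1 → 0 ≤ φ x := fun hx =>
      of_mem_cstarPosCone_one_iff.1 (φ.map_mem_posCone hx)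
    have e1 : φ e = 1 := φ.map_e
    have h1 := key h
    have h2 := key h'
    have h3 : ‖φ ((r : ℂ) • e - w)‖ ≤ s := by
      rw [CStarAlgebra.norm_le_iff_le_algebraMap _ hs.le h1, ← sub_nonneg]
      rw [φ.map_smul_e_sub, Complex.coe_smul] at h2
      rw [Algebra.algebraMap_eq_smul_one]
      exact h2
    have h4 : ‖(1 : A)‖ ≤ 1 := by
      rcases subsingleton_or_nontrivial A with hA | hA
      · simp [Subsingleton.elim (1 : A) 0]
      · simp
    have h5 : φ w = (r : ℂ) • (1 : A) - φ ((r : ℂ) • e - w) := by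
      rw [φ.map_smul_e_sub]
      exact (sub_sub_cancel _ _).symm
    rw [h5]
    refine (norm_sub_le _ _).trans (add_le_add ?_ h3)
    rw [norm_smul, Complex.norm_real, Real.norm_of_nonneg hr.le]
    exact mul_le_of_le_one_right hr.le h4
  obtain ⟨C, hC⟩ := sa _ (realPart v).2
  obtain ⟨D, hD⟩ := sa _ (imaginaryPart v).2
  refine ⟨C + D, fun A _ φ => ?_⟩
  rw [← realPart_add_I_smul_imaginaryPart v, map_add, map_smul]
  refine (norm_add_le _ _).trans (add_le_add (hC A φ) ?_)
  rw [norm_smul, Complex.norm_I, one_mul]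
  exact hD A φ

end CStar

/-! ### The Choi–Effros C*-algebra of fixed points -/

/-- An idempotent ucp map `p` on a C*-algebra with `p (b c) = p (p b · p c)`. -/
structure MulProjection (B : Type*) [CStarAlgebra B] extends UCPMap B B where
  idem : ∀ b, toUCPMap (toUCPMap b) = toUCPMap b
  apply_mul : ∀ b c, toUCPMap (b * c) = toUCPMap (toUCPMap b * toUCPMap c)

namespace MulProjection

variable {B : Type*} [CStarAlgebra B] (p : MulProjection B)

/-- The space of fixed points of `p`. -/
noncomputable def fixed : Submodule ℂ B := LinearMap.eqLocus p.toUCPMap.toLinearMap LinearMap.id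

/-- The space of fixed points of `p`, with the Choi–Effros product `x ∘ y = p (x y)`. -/
noncomputable def Fixed : Type _ := p.fixed

noncomputable instance : NormedAddCommGroup p.Fixed :=
  inferInstanceAs (NormedAddCommGroup p.fixed)

noncomputable instance : NormedSpace ℂ p.Fixed := inferInstanceAs (NormedSpace ℂ p.fixed)

variable {p}

/-- The inclusion of the fixed points. -/
noncomputable def Fixed.val (x : p.Fixed) : B := Subtype.val x

theorem Fixed.ext {x y : p.Fixed} (h : x.val = y.val) : x = y := Subtype.ext h

theorem Fixed.apply_val (x : p.Fixed) : p.toUCPMap x.val = x.val := x.2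

theorem Fixed.norm_def (x : p.Fixed) : ‖x‖ = ‖x.val‖ := rfl

@[simp] theorem Fixed.val_zero : (0 : p.Fixed).val = 0 := rfl
@[simp] theorem Fixed.val_add (x y : p.Fixed) : (x + y).val = x.val + y.val := rfl
@[simp] theorem Fixed.val_smul (c : ℂ) (x : p.Fixed) : (c • x).val = c • x.val := rfl

variable (p)

/-- The compression onto the fixed points. -/
noncomputable def proj (b : B) : p.Fixed := ⟨p.toUCPMap b, p.idem b⟩

@[simp] theorem val_proj (b : B) : (p.proj b).val = p.toUCPMap b := rfl

theorem proj_val (x : p.Fixed) : p.proj x.val = x := Fixed.ext x.apply_val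

noncomputable instance : Mul p.Fixed := ⟨fun x y => p.proj (x.val * y.val)⟩
noncomputable instance : One p.Fixed := ⟨p.proj 1⟩
noncomputable instance : Star p.Fixed := ⟨fun x => p.proj (star x.val)⟩

variable {p}

theorem Fixed.val_mul (x y : p.Fixed) : (x * y).val = p.toUCPMap (x.val * y.val) := rfl

@[simp] theorem Fixed.val_one : (1 : p.Fixed).val = 1 := p.toUCPMap.map_one

@[simp] theorem Fixed.val_star (x : p.Fixed) : (star x).val = star x.val := by
  change p.toUCPMap (star x.val) = _
  rw [UCPMap.map_star, x.apply_val]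

variable (p)

/-- Both sides equal `p (p b · p c)`. With its mirror image, this gives associativity of the
Choi–Effros product. -/
theorem apply_mul_apply (b c : B) : p.toUCPMap (b * p.toUCPMap c) = p.toUCPMap (b * c) := by
  rw [p.apply_mul, p.idem, ← p.apply_mul]

theorem apply_apply_mul (b c : B) : p.toUCPMap (p.toUCPMap b * c) = p.toUCPMap (b * c) := by
  rw [p.apply_mul, p.idem, ← p.apply_mul]

noncomputable instance : NormedRing p.Fixed :=
  { (inferInstance : NormedAddCommGroup p.Fixed) with
    left_distrib := fun x y z => Fixed.ext (by simp [Fixed.val_mul, mul_add])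
    right_distrib := fun x y z => Fixed.ext (by simp [Fixed.val_mul, add_mul])
    zero_mul := fun x => Fixed.ext (by simp [Fixed.val_mul])
    mul_zero := fun x => Fixed.ext (by simp [Fixed.val_mul])
    mul_assoc := fun x y z => Fixed.ext (by
      simp [Fixed.val_mul, apply_mul_apply, apply_apply_mul, mul_assoc])
    one_mul := fun x => Fixed.ext (by simp [Fixed.val_mul, x.apply_val])
    mul_one := fun x => Fixed.ext (by simp [Fixed.val_mul, x.apply_val])
    norm_mul_le := fun x y => (p.toUCPMap.norm_apply_le _).trans (norm_mul_le _ _) }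

theorem isClosed_fixed : IsClosed (p.fixed : Set B) := by
  have hcont : Continuous p.toUCPMap :=
    (p.toUCPMap.toLinearMap.mkContinuous 1 fun b =>
      (p.toUCPMap.norm_apply_le b).trans_eq (one_mul _).symm).continuous
  exact isClosed_eq hcont continuous_id

instance : CompleteSpace p.Fixed := p.isClosed_fixed.completeSpace_coe

section CStar

attribute [local instance] CStarAlgebra.spectralOrder CStarAlgebra.spectralOrderedRing

noncomputable instance : CStarAlgebra p.Fixed :=
  { (inferInstance : NormedRing p.Fixed), (inferInstance : CompleteSpace p.Fixed),
    (inferInstance : NormedSpace ℂ p.Fixed) with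
    algebraMap :=
      { toFun := fun c => c • (1 : p.Fixed)
        map_one' := one_smul _ _
        map_zero' := zero_smul _ _
        map_add' := fun c d => add_smul _ _ _
        map_mul' := fun c d => Fixed.ext (by
          simp [Fixed.val_mul, smul_smul, mul_comm c, p.toUCPMap.map_one]) }
    commutes' := fun c x => Fixed.ext (by
      change p.toUCPMap ((c • (1 : p.Fixed)).val * x.val) =
        p.toUCPMap (x.val * (c • (1 : p.Fixed)).val)
      simp)
    smul_def' := fun c x => Fixed.ext (by
      change c • x.val = p.toUCPMap ((c • (1 : p.Fixed)).val * x.val)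
      simp [x.apply_val])
    star_involutive := fun x => Fixed.ext (by simp)
    star_mul := fun x y => Fixed.ext (by simp [Fixed.val_mul, ← UCPMap.map_star])
    star_add := fun x y => Fixed.ext (by simp)
    star_smul := fun c x => Fixed.ext (by simp)
    -- As `p x = x`, Kadison–Schwarz reads `x* x ≤ p (x* x)` in `B`, and the norm is monotone on
    -- positive elements.
    norm_mul_self_le := fun x => by
      rw [Fixed.norm_def, Fixed.norm_def, Fixed.val_mul, Fixed.val_star,
        ← CStarRing.norm_star_mul_self]
      refine CStarAlgebra.norm_le_norm_of_nonneg_of_le (star_mul_self_nonneg _) ?_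
      simpa only [x.apply_val] using p.toUCPMap.star_mul_self_le x.val }

end CStar

/-- The compression onto the fixed points is a `*`-homomorphism. -/
noncomputable def projHom : B →⋆ₐ[ℂ] p.Fixed where
  toFun := p.proj
  map_one' := rfl
  map_mul' b c := Fixed.ext (p.apply_mul b c)
  map_zero' := Fixed.ext (map_zero p.toUCPMap)
  map_add' b c := Fixed.ext (map_add p.toUCPMap b c)
  commutes' c := Fixed.ext (by
    change p.toUCPMap (algebraMap ℂ B c) = (c • (1 : p.Fixed)).val
    simp [Algebra.algebraMap_eq_smul_one, p.toUCPMap.map_one])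
  map_star' b := Fixed.ext (by simp [UCPMap.map_star])

@[simp] theorem projHom_apply (b : B) : p.projHom b = p.proj b := rfl

/-- The inclusion of the fixed points is a ucp map. -/
noncomputable def inclusion : UCPMap p.Fixed B where
  toFun := Fixed.val
  map_add' _ _ := rfl
  map_smul' _ _ := rfl
  map_e := Fixed.val_one
  map_posCone n M hM := by
    obtain ⟨N, rfl⟩ := (mem_cstarPosCone_iff M).1 hM
    -- A Gram matrix for the Choi–Effros product is the entrywise image under `p` of the Gram matrix
    -- formed in `B`, so complete positivity of `p` applies.
    have : (N.conjTranspose * N).map Fixed.val =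
        ((N.map Fixed.val).conjTranspose * N.map Fixed.val).map p.toUCPMap := by
      ext i j
      have hsum : ∀ (s : Finset (Fin n)) (f : Fin n → p.Fixed),
          (∑ k ∈ s, f k).val = ∑ k ∈ s, (f k).val := fun s f =>
        map_sum p.fixed.subtype f s
      simp [Matrix.mul_apply, Matrix.map_apply, hsum, Fixed.val_mul, map_sum]
    change (N.conjTranspose * N).map Fixed.val ∈ _
    rw [this]
    exact p.toUCPMap.map_mem_posCone (conjTranspose_mul_self_mem_cstarPosCone _)

@[simp] theorem inclusion_apply (x : p.Fixed) : p.inclusion x = x.val := rfl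

end MulProjection

namespace MulProjection

/-- A `*`-homomorphism invariant under `p` restricts to a `*`-homomorphism on the fixed points. -/
noncomputable def lift {B C : Type*} [CStarAlgebra B] [CStarAlgebra C] (p : MulProjection B)
    (k : B →⋆ₐ[ℂ] C) (hk : ∀ b, k (p.toUCPMap b) = k b) : p.Fixed →⋆ₐ[ℂ] C where
  toFun x := k x.val
  map_one' := by simp
  map_mul' x y := by rw [Fixed.val_mul, hk, map_mul]
  map_zero' := by simp
  map_add' x y := by simp
  commutes' c := by
    change k (c • (1 : p.Fixed)).val = _
    simp [Algebra.algebraMap_eq_smul_one]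
  map_star' x := by simp [map_star]

/-- The projection induced by a pair of `*`-homomorphisms that splits in operator systems. -/
noncomputable def ofSplit {A B S : Type*} [CStarAlgebra A] [CStarAlgebra B] [AddCommGroup S]
    [Module ℂ S] [StarAddMonoid S] [StarModule ℂ S] [OperatorSystem S] (f g : A →⋆ₐ[ℂ] B)
    (h : UCPMap B S) (s : UCPMap S B) (t : UCPMap B A) (hfg : ∀ a, h (f a) = h (g a))
    (hs : ∀ x, h (s x) = x) (hg : ∀ b, g (t b) = b) (hf : ∀ b, f (t b) = s (h b)) :
    MulProjection B where
  toUCPMap := s.comp h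
  idem b := by simp [hs]
  apply_mul b c := by
    -- The element `t b * t c` is sent to `b c` by `g` and to `p b · p c` by `f`; the two images
    -- agree after `h`.
    have h1 : g (t b * t c) = b * c := by rw [map_mul, hg, hg]
    have h2 : f (t b * t c) = s (h b) * s (h c) := by rw [map_mul, hf, hf]
    simp only [UCPMap.comp_apply]
    rw [← h2, hfg, h1]

end MulProjection

/-! ### Coequalizers of pairs split in operator systems -/

section Split

open Limits

variable {X Y : UnitalCStarAlg.{u}} {f g : X ⟶ Y} {S : OSys.{u}}
  {h : forgetCStarToOSys.obj Y ⟶ S}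
  (q : IsSplitCoequalizer (forgetCStarToOSys.map f) (forgetCStarToOSys.map g) h)

theorem OSys.congr_hom {V W : OSys.{u}} {φ ψ : V ⟶ W} (h : φ = ψ) (v : V.carrier) :
    (show UCPMap V.carrier W.carrier from φ) v = (show UCPMap V.carrier W.carrier from ψ) v :=
  h ▸ rfl

/-- The projection on the target of a pair of morphisms of C*-algebras that splits in operator
systems. -/
noncomputable def splitProjection : MulProjection Y.carrier :=
  .ofSplit (A := X.carrier) (S := S.carrier) f g h q.rightSection q.leftSection
    (OSys.congr_hom q.condition) (OSys.congr_hom q.rightSection_π)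
    (OSys.congr_hom q.leftSection_bottom) (OSys.congr_hom q.leftSection_top)

/-- The target of the coequalizer of a pair that splits in operator systems. -/
noncomputable def splitCoequalizer : UnitalCStarAlg.{u} := ⟨(splitProjection q).Fixed⟩

/-- The coequalizer map of a pair that splits in operator systems. -/
noncomputable def splitCoequalizerπ : Y ⟶ splitCoequalizer q := (splitProjection q).projHom

theorem splitCoequalizer_condition : f ≫ splitCoequalizerπ q = g ≫ splitCoequalizerπ q :=
  StarAlgHom.ext fun a => MulProjection.Fixed.ext
    (congrArg (show UCPMap S.carrier Y.carrier from q.rightSection)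
      (OSys.congr_hom q.condition a))

/-- With `t` the left section, `k (p b) = k (f (t b)) = k (g (t b)) = k b`. Thus `k` factors through
the fixed points. -/
theorem apply_splitProjection {Z : UnitalCStarAlg.{u}} (k : Y ⟶ Z) (hk : f ≫ k = g ≫ k)
    (b : Y.carrier) : (show Y.carrier →⋆ₐ[ℂ] Z.carrier from k)
      ((splitProjection q).toUCPMap b) = (show Y.carrier →⋆ₐ[ℂ] Z.carrier from k) b := by
  have h1 := OSys.congr_hom q.leftSection_top b
  have h2 := OSys.congr_hom q.leftSection_bottom b
  have h3 := DFunLike.congr_fun (F := X.carrier →⋆ₐ[ℂ] Z.carrier) hk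
    ((show UCPMap Y.carrier X.carrier from q.leftSection) b)
  exact ((congrArg k.toFun h1).symm.trans h3).trans (congrArg k.toFun h2)

/-- A pair that splits in operator systems has a coequalizer in C*-algebras. -/
noncomputable def isColimitSplitCoequalizer :
    IsColimit (Cofork.ofπ (splitCoequalizerπ q) (splitCoequalizer_condition q)) :=
  Cofork.IsColimit.mk' _ fun s =>
    ⟨(splitProjection q).lift s.π (apply_splitProjection q s.π s.condition),
      StarAlgHom.ext fun b => apply_splitProjection q s.π s.condition b,
      fun {m} hm => StarAlgHom.ext fun x =>
        (congrArg m.toFun ((splitProjection q).proj_val x)).symm.trans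
          (DFunLike.congr_fun (F := Y.carrier →⋆ₐ[ℂ] s.pt.carrier) hm x.val)⟩

/-- The forgetful functor maps the coequalizer to a split coequalizer. -/
noncomputable def isSplitCoequalizerMap :
    IsSplitCoequalizer (forgetCStarToOSys.map f) (forgetCStarToOSys.map g)
      (forgetCStarToOSys.map (splitCoequalizerπ q)) where
  rightSection := (splitProjection q).inclusion
  leftSection := q.leftSection
  condition := by
    rw [← Functor.map_comp, splitCoequalizer_condition, Functor.map_comp]
  rightSection_π := UCPMap.ext_apply fun x => (splitProjection q).proj_val x
  leftSection_bottom := q.leftSection_bottom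
  leftSection_top := q.leftSection_top

noncomputable def isColimitMapSplitCoequalizer : IsColimit (forgetCStarToOSys.mapCocone
    (Cofork.ofπ (splitCoequalizerπ q) (splitCoequalizer_condition q))) :=
  (isColimitMapCoconeCoforkEquiv forgetCStarToOSys (splitCoequalizer_condition q)).symm
    (isSplitCoequalizerMap q).isCoequalizer

end Split

instance : Monad.HasCoequalizerOfIsSplitPair forgetCStarToOSys.{u} where
  out f g _ :=
    ⟨⟨⟨_, isColimitSplitCoequalizer (HasSplitCoequalizer.isSplitCoequalizer
      (forgetCStarToOSys.map f) (forgetCStarToOSys.map g))⟩⟩⟩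

instance : Monad.PreservesColimitOfIsSplitPair forgetCStarToOSys.{u} where
  out f g _ := Limits.preservesColimit_of_preserves_colimit_cocone
    (isColimitSplitCoequalizer (HasSplitCoequalizer.isSplitCoequalizer
      (forgetCStarToOSys.map f) (forgetCStarToOSys.map g)))
    (isColimitMapSplitCoequalizer _)

/-- A ucp inverse of a `*`-homomorphism is its set-theoretic inverse, hence automatically
multiplicative. -/
instance : forgetCStarToOSys.{u}.ReflectsIsomorphisms where
  reflects {A B} f hf := by
    let F : A.carrier →⋆ₐ[ℂ] B.carrier := f
    let φ : UCPMap B.carrier A.carrier := inv (forgetCStarToOSys.map f)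
    have h1 : ∀ a, φ (F a) = a := OSys.congr_hom (IsIso.hom_inv_id (forgetCStarToOSys.map f))
    have h2 : ∀ b, F (φ b) = b := OSys.congr_hom (IsIso.inv_hom_id (forgetCStarToOSys.map f))
    have hF : Function.Injective F := Function.LeftInverse.injective h1
    let G : B.carrier →⋆ₐ[ℂ] A.carrier :=
      { toFun := φ
        map_one' := φ.map_one
        map_mul' := fun x y => hF (by rw [h2, map_mul, h2, h2])
        map_zero' := map_zero φ
        map_add' := map_add φ
        commutes' := fun c => hF (by rw [h2, AlgHomClass.commutes])
        map_star' := φ.map_star }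
    exact ⟨G, StarAlgHom.ext h1, StarAlgHom.ext h2⟩

/-! ### Transport of C*-structures to sets of bounded size -/

section Transport

variable {X A : Type*} [CStarAlgebra A] (e : X ≃ A)

/-- Transport of a C*-algebra structure along a bijection. -/
@[reducible]
noncomputable def Equiv.cStarAlgebra : CStarAlgebra X :=
  letI := e.normedRing
  letI := e.algebra ℂ
  letI : Star X := ⟨fun x => e.symm (star (e x))⟩
  have hn : ∀ x : X, ‖x‖ = ‖e x‖ := fun _ => rfl
  have hi : Isometry e := Isometry.of_dist_eq fun _ _ => rfl
  have hm : ∀ x y : X, e (x * y) = e x * e y := fun _ _ => e.apply_symm_apply _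
  have ha : ∀ x y : X, e (x + y) = e x + e y := fun _ _ => e.apply_symm_apply _
  have hc : ∀ (c : ℂ) (x : X), e (c • x) = c • e x := fun _ _ => e.apply_symm_apply _
  have hs : ∀ x : X, e (star x) = star (e x) := fun _ => e.apply_symm_apply _
  { e.normedRing, e.algebra ℂ with
    star_involutive := fun x => e.injective (by simp [hs])
    star_mul := fun x y => e.injective (by simp [hs, hm])
    star_add := fun x y => e.injective (by simp [hs, ha])
    star_smul := fun c x => e.injective (by simp [hs, hc])
    norm_smul_le := fun c x => by rw [hn, hn, hc]; exact norm_smul_le _ _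
    complete := ((completeSpace_congr (α := X) (β := A) (e := e) hi.isUniformEmbedding).2
      inferInstance).complete
    norm_mul_self_le := fun x => by
      rw [hn, hn, hm, hs, CStarRing.norm_star_mul_self] }

/-- The transported C*-algebra is isomorphic to the original one. -/
noncomputable def Equiv.cStarAlgEquiv : letI := e.cStarAlgebra; X ≃⋆ₐ[ℂ] A :=
  letI := e.cStarAlgebra
  { e with
    map_mul' := fun _ _ => e.apply_symm_apply _
    map_add' := fun _ _ => e.apply_symm_apply _
    map_star' := fun _ => e.apply_symm_apply _
    map_smul' := fun _ _ => e.apply_symm_apply _ }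

end Transport

/-! ### The C*-algebra generated by a ucp image -/

section Generated

variable {V : Type*} [AddCommGroup V] [Module ℂ V] [StarAddMonoid V] [StarModule ℂ V]
  [OperatorSystem V] {A : Type*} [CStarAlgebra A] (φ : UCPMap V A)

/-- The C*-subalgebra generated by the range of a ucp map. -/
noncomputable def UCPMap.generated : StarSubalgebra ℂ A :=
  (StarAlgebra.adjoin ℂ (Set.range φ)).topologicalClosure

instance UCPMap.isClosed_generated : Fact (IsClosed (φ.generated : Set A)) :=
  ⟨StarSubalgebra.isClosed_topologicalClosure _⟩

noncomputable instance : CStarAlgebra φ.generated :=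
  StarSubalgebra.cstarAlgebra _ (h_closed := φ.isClosed_generated.out)

theorem UCPMap.apply_mem_generated (v : V) : φ v ∈ φ.generated :=
  StarSubalgebra.le_topologicalClosure _ (StarAlgebra.subset_adjoin ℂ _ ⟨v, rfl⟩)

/-- The corestriction of a ucp map to the C*-algebra generated by its range. -/
noncomputable def UCPMap.toGenerated : UCPMap V φ.generated where
  toFun v := ⟨φ v, φ.apply_mem_generated v⟩
  map_add' v w := Subtype.ext (map_add φ v w)
  map_smul' c v := Subtype.ext (map_smul φ c v)
  map_e := Subtype.ext φ.map_e
  map_posCone n M hM :=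
    mem_cstarPosCone_of_map (f := φ.generated.subtype) Subtype.val_injective
      (φ.map_posCone n M hM)

/-- A `*`-homomorphism on the C*-algebra generated by the range of a ucp map is determined on
that range. -/
theorem UCPMap.generated_hom_ext {B : Type*} [CStarAlgebra B] {f g : φ.generated →⋆ₐ[ℂ] B}
    (h : ∀ v, f (φ.toGenerated v) = g (φ.toGenerated v)) : f = g := by
  have hf : Continuous f := AddMonoidHomClass.continuous_of_bound f 1 fun x =>
    (NonUnitalStarAlgHom.norm_apply_le f x).trans_eq (one_mul _).symm
  have hg : Continuous g := AddMonoidHomClass.continuous_of_bound g 1 fun x =>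
    (NonUnitalStarAlgHom.norm_apply_le g x).trans_eq (one_mul _).symm
  refine StarAlgHom.ext_topologicalClosure hf hg ?_
  refine StarAlgHom.ext_adjoin ?_
  rintro ⟨_, hx⟩ ⟨v, rfl⟩
  exact h v

/-- The range of `φ` is already closed under `star`, so noncommutative polynomials in it without
adjoints suffice. -/
theorem UCPMap.adjoin_range_toSubalgebra : (StarAlgebra.adjoin ℂ (Set.range φ)).toSubalgebra =
    (FreeAlgebra.lift ℂ φ).range := by
  rw [StarAlgebra.adjoin_toSubalgebra, ← Algebra.adjoin_range_eq_range_freeAlgebra_lift]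
  congr 1
  refine Set.union_eq_left.2 ?_
  rintro a ⟨v, hv⟩
  exact ⟨star v, by rw [φ.map_star, hv, star_star]⟩

/-- The C*-algebra generated by the range of a ucp map has bounded cardinality. -/
theorem UCPMap.exists_injective_generated :
    ∃ j : φ.generated → ℕ → FreeAlgebra ℂ V, Function.Injective j := by
  -- Each element is the limit of a sequence of noncommutative polynomials in the image; a chosen
  -- sequence determines its limit, which gives injectivity.
  have key : ∀ a : φ.generated, ∃ x : ℕ → FreeAlgebra ℂ V,
      Filter.Tendsto (fun n => FreeAlgebra.lift ℂ φ (x n)) Filter.atTop (nhds (a : A)) := by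
    intro a
    have ha : (a : A) ∈ closure (StarAlgebra.adjoin ℂ (Set.range φ) : Set A) := a.2
    obtain ⟨y, hy, hlim⟩ := mem_closure_iff_seq_limit.1 ha
    have hy' : ∀ n, ∃ x, FreeAlgebra.lift ℂ φ x = y n := fun n => by
      have : y n ∈ (StarAlgebra.adjoin ℂ (Set.range φ)).toSubalgebra := hy n
      rwa [φ.adjoin_range_toSubalgebra] at this
    choose x hx using hy'
    exact ⟨x, by simpa only [hx] using hlim⟩
  choose j hj using key
  refine ⟨j, fun a b hab => Subtype.ext (tendsto_nhds_unique (hj a) ?_)⟩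
  rw [hab]
  exact hj b

end Generated

/-! ### Bounded products of C*-algebras -/

noncomputable instance lp.cStarAlgebra {I : Type*} {A : I → Type*} [∀ i, Nontrivial (A i)]
    [∀ i, CStarAlgebra (A i)] : CStarAlgebra (lp A ∞) where

/-- Evaluation of bounded families at an index. -/
noncomputable def lp.evalStarAlgHom {I : Type*} (A : I → Type*) [∀ i, Nontrivial (A i)]
    [∀ i, CStarAlgebra (A i)] (i : I) : lp A ∞ →⋆ₐ[ℂ] A i where
  toFun x := x i
  map_one' := rfl
  map_mul' _ _ := rfl
  map_zero' := rfl
  map_add' _ _ := rfl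
  commutes' _ := rfl
  map_star' _ := rfl

section CStar

attribute [local instance] CStarAlgebra.spectralOrder CStarAlgebra.spectralOrderedRing

/-- The diagonal entry is a sum of positive terms, one of which is `star (N k j) * N k j`. This
keeps square roots chosen factor by factor uniformly bounded. -/
theorem norm_sq_le_norm_conjTranspose_mul_self {A : Type*} [CStarAlgebra A] {n : ℕ}
    (N : Matrix (Fin n) (Fin n) A) (k j : Fin n) :
    ‖N k j‖ ^ 2 ≤ ‖(N.conjTranspose * N) j j‖ := by
  rw [sq, ← CStarRing.norm_star_mul_self, Matrix.mul_apply]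
  exact CStarAlgebra.norm_le_norm_of_nonneg_of_le (star_mul_self_nonneg _)
    (Finset.single_le_sum (f := fun l => star (N l j) * N l j)
      (fun l _ => star_mul_self_nonneg _) (Finset.mem_univ k))

end CStar

/-- A family of ucp maps into nontrivial C*-algebras induces a ucp map into the C*-algebra of
bounded families. -/
noncomputable def UCPMap.pi {V : Type*} [AddCommGroup V] [Module ℂ V] [StarAddMonoid V]
    [StarModule ℂ V] [OperatorSystem V] {I : Type*} {A : I → Type u} [∀ i, Nontrivial (A i)]
    [∀ i, CStarAlgebra (A i)] (φ : ∀ i, UCPMap V (A i)) : UCPMap V (lp A ∞) where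
  toFun v := ⟨fun i => φ i v, memℓp_infty <| by
    obtain ⟨C, hC⟩ := OperatorSystem.exists_norm_apply_le.{u} v
    exact ⟨C, by rintro _ ⟨i, rfl⟩; exact hC _ (φ i)⟩⟩
  map_add' v w := lp.ext (funext fun i => map_add (φ i) v w)
  map_smul' c v := lp.ext (funext fun i => map_smul (φ i) c v)
  map_e := lp.ext (funext fun i => (φ i).map_e)
  map_posCone n M hM := by
    -- Positivity in the product is witnessed by square roots chosen in each factor; their entries
    -- are bounded by `√C`, where `C` bounds all images of `M j j`.
    choose N hN using fun i => (mem_cstarPosCone_iff _).1 ((φ i).map_posCone n M hM)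
    have hb : ∀ k j, Memℓp (fun i => N i k j) ∞ := fun k j => by
      obtain ⟨C, hC⟩ := OperatorSystem.exists_norm_apply_le.{u} (M j j)
      refine memℓp_infty ⟨√C, ?_⟩
      rintro _ ⟨i, rfl⟩
      refine Real.le_sqrt_of_sq_le ((norm_sq_le_norm_conjTranspose_mul_self (N i) k j).trans ?_)
      rw [← hN i]
      exact hC _ (φ i)
    refine (mem_cstarPosCone_iff _).2 ⟨Matrix.of fun k j => ⟨fun i => N i k j, hb k j⟩, ?_⟩
    ext k j i
    have h := congrFun (congrFun (hN i) k) j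
    rw [Matrix.mul_apply] at h
    rw [Matrix.mul_apply]
    exact h.trans (map_sum (lp.evalStarAlgHom A i) (fun l =>
      (Matrix.of fun k j => (⟨fun i => N i k j, hb k j⟩ : lp A ∞)).conjTranspose k l *
        (⟨fun i => N i l j, hb l j⟩ : lp A ∞)) Finset.univ).symm

/-! ### The universal C*-algebra of an operator system -/

section Free

variable (V : Type u) [AddCommGroup V] [Module ℂ V] [StarAddMonoid V] [StarModule ℂ V]
  [OperatorSystem V]

/-- Ucp maps from `V` into nontrivial C*-algebras carried by subsets of a fixed set. -/
structure UCPIndex : Type u where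
  carrier : Set (ℕ → FreeAlgebra ℂ V)
  [cStarAlgebra : CStarAlgebra carrier]
  [nontrivial : Nontrivial carrier]
  toUCPMap : UCPMap V carrier

attribute [instance] UCPIndex.cStarAlgebra UCPIndex.nontrivial

/-- The joint ucp map. -/
noncomputable def UCPIndex.joint :
    UCPMap V (lp (fun i : UCPIndex V => (i.carrier : Type u)) ∞) :=
  UCPMap.pi fun i => i.toUCPMap

variable {V}

/-- Corestrict `φ` to the C*-algebra generated by its range and move that algebra onto a subset of
`ℕ → FreeAlgebra ℂ V`. The index family is therefore large enough for every nontrivial target. -/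
theorem UCPMap.exists_index {B : Type u} [CStarAlgebra B] [Nontrivial B] (φ : UCPMap V B) :
    ∃ (i : UCPIndex V) (ψ : i.carrier →⋆ₐ[ℂ] B), ∀ v, ψ (i.toUCPMap v) = φ v := by
  obtain ⟨j, hj⟩ := φ.exists_injective_generated
  let e : Set.range j ≃ φ.generated := (Equiv.ofInjective j hj).symm
  let := e.cStarAlgebra
  have : Nontrivial (Set.range j) := e.nontrivial
  let E : Set.range j ≃⋆ₐ[ℂ] φ.generated := e.cStarAlgEquiv
  refine ⟨⟨Set.range j, (StarAlgHom.toUCPMap (E.symm : φ.generated →⋆ₐ[ℂ] Set.range j)).comp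
    φ.toGenerated⟩, φ.generated.subtype.comp (E : Set.range j →⋆ₐ[ℂ] φ.generated), fun v => ?_⟩
  exact congrArg Subtype.val (E.apply_symm_apply (φ.toGenerated v))

variable (V) in
/-- The universal C*-algebra of an operator system. -/
noncomputable def universalCStarAlg : UnitalCStarAlg.{u} := ⟨(UCPIndex.joint V).generated⟩

variable (V) in
/-- The universal ucp map. -/
noncomputable def universalUCPMap : UCPMap V (universalCStarAlg V).carrier :=
  (UCPIndex.joint V).toGenerated

theorem universalCStarAlg_hom_ext {B : Type u} [CStarAlgebra B]
    {f g : (universalCStarAlg V).carrier →⋆ₐ[ℂ] B}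
    (h : ∀ v, f (universalUCPMap V v) = g (universalUCPMap V v)) : f = g :=
  (UCPIndex.joint V).generated_hom_ext h

theorem exists_universalCStarAlg_hom {B : Type u} [CStarAlgebra B] (φ : UCPMap V B) :
    ∃ f : (universalCStarAlg V).carrier →⋆ₐ[ℂ] B, ∀ v, f (universalUCPMap V v) = φ v := by
  -- The zero algebra is not among the indexed targets, and is handled separately.
  rcases subsingleton_or_nontrivial B with hB | hB
  · exact ⟨{ toFun := 0
             map_one' := Subsingleton.elim _ _
             map_mul' := fun _ _ => Subsingleton.elim _ _
             map_zero' := rfl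
             map_add' := fun _ _ => Subsingleton.elim _ _
             commutes' := fun _ => Subsingleton.elim _ _
             map_star' := fun _ => Subsingleton.elim _ _ }, fun _ => Subsingleton.elim _ _⟩
  · obtain ⟨i, ψ, hψ⟩ := φ.exists_index
    exact ⟨(ψ.comp (lp.evalStarAlgHom (fun i : UCPIndex V => (i.carrier : Type u)) i)).comp
      (UCPIndex.joint V).generated.subtype, hψ⟩

end Free

/-! ### The adjunction and monadicity -/

/-- The universal property of the universal C*-algebra. -/
noncomputable def universalHomEquiv (V : OSys.{u}) (B : UnitalCStarAlg.{u}) :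
    (universalCStarAlg V.carrier ⟶ B) ≃ (V ⟶ forgetCStarToOSys.obj B) :=
  Equiv.ofBijective
    (fun f => (StarAlgHom.toUCPMap f).comp (universalUCPMap V.carrier))
    ⟨fun _ _ h => universalCStarAlg_hom_ext (B := B.carrier)
      (OSys.congr_hom (W := forgetCStarToOSys.obj B) h),
      fun φ => (exists_universalCStarAlg_hom (B := B.carrier) φ).imp fun _ hf =>
        UCPMap.ext_apply hf⟩

/-- The forgetful functor has a left adjoint. -/
noncomputable def universalAdjunction :
    Adjunction.leftAdjointOfEquiv (G := forgetCStarToOSys.{u}) universalHomEquiv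
      (fun _ _ _ _ _ => UCPMap.ext_apply fun _ => rfl) ⊣ forgetCStarToOSys.{u} :=
  Adjunction.adjunctionOfEquivLeft _ _

/-- Beck's theorem, fed by the adjunction and by the instances on split pairs and on reflection of
isomorphisms. -/
theorem mainTheorem9 :
    Nonempty (CategoryTheory.MonadicRightAdjoint forgetCStarToOSys.{u}) :=
  ⟨Monad.monadicOfHasPreservesGSplitCoequalizersOfReflectsIsomorphisms universalAdjunction⟩
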